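/- Let $\mathcal T=(\mathcal V,\mathcal E)$ be a finite tree (radial grid) whose root, the substation, has degree one, with depth $d$ (the largest number of edges on a path from a node to the root), and let $\mathcal E_{full}\supseteq\mathcal E$ be a set of permissible edges on $\mathcal V$. Each operational line $(ab)\in\mathcal E$ has resistance $r_{ab}\in[r_{\min},r_{\max}]$ and reactance $x_{ab}\in[x_{\min},x_{\max}]$, with $r_{\min},x_{\min}>0$. Given active and reactive injections $p_a,q_a$ at the non-root nodes $a$, the voltage magnitudes $v$ and phases $\theta$, measured as deviations from those at the root (so that both are $0$ at the root), satisfy the linear coupled power flow equations $$p_a=\sum_{b:(ab)\in\mathcal E}\frac{r_{ab}(v_a-v_b)+x_{ab}(\theta_a-\theta_b)}{x_{ab}^2+r_{ab}^2},\qquad q_a=\sum_{b:(ab)\in\mathcal E}\frac{x_{ab}(v_a-v_b)-r_{ab}(\theta_a-\theta_b)}{x_{ab}^2+r_{ab}^2}$$ at every non-root node $a$. The vector $(p,q)$ of injections at the non-root nodes is a zero-mean jointly Gaussian vector; injections at different nodes are uncorrelated ($\mathrm{Cov}(p_a,p_b)=\mathrm{Cov}(q_a,q_b)=\mathrm{Cov}(q_a,p_b)=0$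 for $a\ne b$), those at the same node are non-negatively correlated ($\mathrm{Cov}(q_a,p_a)\ge 0$), and the variances are bounded above and away from zero: $\mathrm{Var}(p_a)\le\sigma^2_{\max}$, $\mathrm{Var}(q_a)\le\sigma^2_{\max}$ and $\mathrm{Var}(p_a)+\mathrm{Var}(q_a)\ge\sigma^2_{\min}>0$ for every non-root node $a$. Then there is a constant $C>0$, depending only on $r_{\min},r_{\max},x_{\min},x_{\max},\sigma^2_{\min},\sigma^2_{\max}$, such that for every such grid, every such injection law and every $0<\eta<1$ the following holds. Let $v^{1},\dots,v^{n}$ be the voltage magnitude vectors that result from $n$ independent samples of the injections, and weight each permissible edge $(ab)\in\mathcal E_{full}$ by the empirical estimate $$\hat\phi_{ab}=\frac1n\sum_{k=1}^n\bigl(v^{k}_a-v^{k}_b\bigr)^2$$ of $\phi_{ab}=\mathbb E[(v_a-v_b)^2]$. If $$n> C\,d^4\,|\mathcal V|^2\log\bigl(|\mathcal V|/\eta\bigr),$$ then with probability at least $1-\eta$ the minimum weight spanning tree of $(\mathcal V,\mathcal E_{full})$ for the weights $\hat\phi$ is unique and its edge set is the true operational edge set $\mathcal E$. -/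

import Mathlib

open MeasureTheory ProbabilityTheory

/-- The buses other than the substation `root`. -/
abbrev NonRoot {V : Type*} (root : V) : Type _ := {a : V // a ≠ root}

/-- Injections at the non-substation buses: the pair `(p, q)` of the vector of active injections
and the vector of reactive injections. -/
abbrev Injection {V : Type*} (root : V) : Type _ := (NonRoot root → ℝ) × (NonRoot root → ℝ)

open Classical in
/-- The linear coupled power flow equations (LC-PF) of the grid with operational lines `T`, line
resistances `r` and line reactances `x`. Voltage magnitudes `v` and phases `θ` are measured as
deviations from those of the reference bus `root`; the equations are imposed at all other buses. -/
structure IsLCPF {V : Type*} [Fintype V] (T : SimpleGraph V) (root : V) (r x : Sym2 V → ℝ)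
    (s : Injection root) (v θ : V → ℝ) : Prop where
  v_root : v root = 0
  θ_root : θ root = 0
  active : ∀ a : NonRoot root, s.1 a = ∑ b : V, if T.Adj a b then
    (r s(a, b) * (v a - v b) + x s(a, b) * (θ a - θ b)) / (x s(a, b) ^ 2 + r s(a, b) ^ 2) else 0
  reactive : ∀ a : NonRoot root, s.2 a = ∑ b : V, if T.Adj a b then
    (x s(a, b) * (v a - v b) - r s(a, b) * (θ a - θ b)) / (x s(a, b) ^ 2 + r s(a, b) ^ 2) else 0

/-- The law `μ` of the nodal injections is a zero-mean (jointly) Gaussian law for which injections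
at different buses are uncorrelated, while active and reactive injections at the same bus are
non-negatively correlated. -/
structure IsInjectionLaw {V : Type*} {root : V} (μ : Measure (Injection root)) : Prop where
  gaussian : IsGaussian μ
  mean_p : ∀ a, ∫ s, s.1 a ∂μ = 0
  mean_q : ∀ a, ∫ s, s.2 a ∂μ = 0
  cov_p : ∀ a b, a ≠ b → cov[fun s ↦ s.1 a, fun s ↦ s.1 b; μ] = 0
  cov_q : ∀ a b, a ≠ b → cov[fun s ↦ s.2 a, fun s ↦ s.2 b; μ] = 0
  cov_qp : ∀ a b, a ≠ b → cov[fun s ↦ s.2 a, fun s ↦ s.1 b; μ] = 0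
  cov_qp_self : ∀ a, 0 ≤ cov[fun s ↦ s.2 a, fun s ↦ s.1 a; μ]

/-- The depth of the tree `T` rooted at `root`: the largest number of lines on the path from
a bus to the root. -/
noncomputable def treeDepth {V : Type*} [Fintype V] (T : SimpleGraph V) (root : V) : ℕ :=
  Finset.univ.sup fun a ↦ T.dist root a

/-- The empirical estimate of `φ_ab = 𝔼[(v_a - v_b)²]` from `n` samples of the (zero-mean)
voltage magnitude deviations, as a function of the unordered pair `ab`. -/
noncomputable def empiricalPhi {V : Type*} {n : ℕ} (v : Fin n → V → ℝ) : Sym2 V → ℝ :=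
  Sym2.lift ⟨fun a b ↦ (∑ k, (v k a - v k b) ^ 2) / n, fun a b ↦ by
    simp only [fun k ↦ sub_sq_comm (v k a) (v k b)]⟩

open Classical in
/-- The total weight of the edges of a graph. -/
noncomputable def graphWeight {V : Type*} [Fintype V] (w : Sym2 V → ℝ) (S : SimpleGraph V) : ℝ :=
  ∑ e ∈ S.edgeFinset, w e

/-- `S` is a spanning tree of `G` (on all the vertices of `G`). -/
def IsSpanningTree {V : Type*} (G S : SimpleGraph V) : Prop := S ≤ G ∧ S.IsTree

/-- `S` is a minimum weight spanning tree of `G` for the edge weights `w`. -/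
def IsMinSpanningTree {V : Type*} [Fintype V] (G : SimpleGraph V) (w : Sym2 V → ℝ)
    (S : SimpleGraph V) : Prop :=
  IsSpanningTree G S ∧ ∀ S', IsSpanningTree G S' → graphWeight w S ≤ graphWeight w S'

/-- The possible outputs of the learning algorithm run on the voltage magnitude samples `v` and the
set of permissible lines `G`: the minimum weight spanning trees of `G` for the empirical `φ`
(which of them is returned in case of a tie is left open). -/
def mstOutputs {V : Type*} [Fintype V] {n : ℕ} (G : SimpleGraph V) (v : Fin n → V → ℝ) :
    Set (SimpleGraph V) :=
  {S | IsMinSpanningTree G (empiricalPhi v) S}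

/-!
In a tree, each line `cd` carries the net injection of the buses that it separates from the root,
so the power flow equations are solved explicitly: `v c - v d` is the sum, over the buses `u` that
`cd` separates from the root, of `± (r p_u + x q_u)` (`IsLCPF.sub_eq_sum`), the sign being that of
`unitFlow`. Summing along the path from `a` to `b` shows that `v a - v b` is a linear combination of
the injections. Deleting successive edges of the path cuts off larger and larger sets of vertices
behind (`sideOf_subset_sideOf`); hence a given injection `u` contributes with the same sign to the
drops along all the lines of the path. As the correlations are nonnegative, the variance
`φ_ab` of `v a - v b` is at least the sum of the variances along the lines of the path
(`sum_dropVar_le_dropVar`). Each of these is at least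
`γ = min(rmin, xmin) ^ 2 * varmin`, so `φ_ab` exceeds every `φ_e`, for `e` on the path, by `γ`
as soon as `ab` is not itself a line (`dropVar_cons_nil_add_le`).

If all the empirical weights are within `γ / 2` of the true ones, every edge outside the tree is
therefore strictly heavier than the tree edges on the path that joins its ends, and an exchange
argument shows that the tree is the unique minimum weight spanning tree
(`setOf_isMinSpanningTree_eq_singleton`).

It remains to estimate the deviations. Differences of voltages are centred Gaussian variables whose
variance is at most `B`, of order `d ^ 2 * |V|` (`dropVar_le`). Chernoff's bound, with the moment
generating function `(1 - 2 t φ) ^ (-1 / 2)` of the square of a Gaussian variable, gives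
`2 * exp (-n ε ^ 2 / (8 B ^ 2))` as a bound for the probability that an empirical weight is off by
`ε` (`measureReal_abs_sum_sq_div_sub_ge_le`). A union bound over the pairs of buses, with
`ε = γ / 2`, concludes: `n ε ^ 2 / (8 B ^ 2)` is at least `3 * log (|V| / η)`.
-/

/-! ### Exchange of edges and minimum spanning trees -/

namespace SimpleGraph

variable {V : Type*}

/-- Deleting the edge `ab` from a connected graph leaves at most two components, that of `a` and
that of `b`. -/
lemma Connected.reachable_deleteEdges_or {S : SimpleGraph V} (hS : S.Connected) (a b u : V) :
    (S.deleteEdges {s(a, b)}).Reachable u a ∨ (S.deleteEdges {s(a, b)}).Reachable u b := by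
  obtain ⟨p⟩ := hS.preconnected u a
  suffices H : ∀ {u t : V} (_ : S.Walk u t), t = a →
      (S.deleteEdges {s(a, b)}).Reachable u a ∨ (S.deleteEdges {s(a, b)}).Reachable u b from
    H p rfl
  intro u t p ht
  induction p with
  | nil => subst ht; exact Or.inl (Reachable.refl _)
  | @cons u w t h p ih =>
    by_cases he : s(u, w) = s(a, b)
    · rcases Sym2.eq_iff.1 he with ⟨rfl, -⟩ | ⟨rfl, -⟩
      · exact Or.inl (Reachable.refl _)
      · exact Or.inr (Reachable.refl _)
    · have huw : (S.deleteEdges {s(a, b)}).Reachable u w :=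
        Adj.reachable (by simpa [deleteEdges_adj, h] using he)
      exact (ih ht).imp huw.trans huw.trans

/-- The exchange step: after deleting the edge `ab` from a tree, any edge `cd` between the two
components completes it to a tree again. -/
lemma IsTree.deleteEdges_sup_edge {S : SimpleGraph V} (hS : S.IsTree) {a b c d : V}
    (hca : (S.deleteEdges {s(a, b)}).Reachable c a)
    (hda : ¬ (S.deleteEdges {s(a, b)}).Reachable d a) :
    (S.deleteEdges {s(a, b)} ⊔ edge c d).IsTree := by
  have hcd : ¬ (S.deleteEdges {s(a, b)}).Reachable c d := fun h ↦ hda (h.symm.trans hca)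
  have hdb := (hS.connected.reachable_deleteEdges_or a b d).resolve_left hda
  have hle : S.deleteEdges {s(a, b)} ≤ S.deleteEdges {s(a, b)} ⊔ edge c d := le_sup_left
  have hne : c ≠ d := by rintro rfl; exact hda hca
  have hadj : (S.deleteEdges {s(a, b)} ⊔ edge c d).Reachable c d :=
    Adj.reachable (Or.inr (by simp [edge_adj, hne]))
  refine ⟨(connected_iff_exists_forall_reachable _).2 ⟨a, fun u ↦ ?_⟩,
    (hS.isAcyclic.anti (deleteEdges_le _)).sup_edge_of_not_reachable hcd⟩
  rcases hS.connected.reachable_deleteEdges_or a b u with h | h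
  · exact (h.mono hle).symm
  · exact ((hca.mono hle).symm.trans hadj).trans ((hdb.mono hle).trans (h.mono hle).symm)

end SimpleGraph

open SimpleGraph

section SpanningTree

variable {V : Type*} [Fintype V]

open Classical in
lemma graphWeight_deleteEdges_sup_edge (w : Sym2 V → ℝ) {S : SimpleGraph V} {a b c d : V}
    (hab : S.Adj a b) (hcd : c ≠ d) (hS : ¬ (S.deleteEdges {s(a, b)}).Adj c d) :
    graphWeight w (S.deleteEdges {s(a, b)} ⊔ edge c d) =
      graphWeight w S - w s(a, b) + w s(c, d) := by
  have h1 : (S.deleteEdges {s(a, b)} ⊔ edge c d).edgeFinset =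
      insert s(c, d) (S.edgeFinset.erase s(a, b)) := by
    ext e
    simp only [mem_edgeFinset, edgeSet_sup, edgeSet_deleteEdges, edgeSet_edge_of_ne hcd,
      Finset.mem_insert, Finset.mem_erase, Set.mem_union, Set.mem_sdiff, Set.mem_singleton_iff]
    tauto
  have h2 : s(c, d) ∉ S.edgeFinset.erase s(a, b) := by
    simpa [deleteEdges_adj, and_comm, imp_not_comm] using hS
  have h3 : graphWeight w (S.deleteEdges {s(a, b)} ⊔ edge c d) =
      ∑ e ∈ insert s(c, d) (S.edgeFinset.erase s(a, b)), w e := by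
    rw [← h1, graphWeight]
    congr!
  rw [h3, Finset.sum_insert h2, graphWeight,
    ← Finset.add_sum_erase S.edgeFinset w (mem_edgeFinset.2 ((mem_edgeSet S).2 hab))]
  ring

/-- Cycle criterion for minimum spanning trees: if every edge `ab` outside the spanning tree `T` is
strictly heavier than each edge of the path of `T` from `a` to `b`, then `T` is the unique minimum
weight spanning tree. -/
theorem setOf_isMinSpanningTree_eq_singleton {G T : SimpleGraph V} (w : Sym2 V → ℝ)
    (hT : T.IsTree) (hTG : T ≤ G)
    (hw : ∀ a b, a ≠ b → ¬ T.Adj a b → ∀ p : T.Walk a b, p.IsPath → ∀ e ∈ p.darts,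
      w e.edge < w s(a, b)) :
    {S | IsMinSpanningTree G w S} = {T} := by
  classical
  have huniq : ∀ S, IsMinSpanningTree G w S → S = T := by
    rintro S ⟨⟨hSG, hS⟩, hmin⟩
    have hST : S ≤ T := by
      intro a b hab
      by_contra habT
      obtain ⟨p, hp⟩ := (hT.connected.preconnected a b).exists_isPath
      have hbr := isAcyclic_iff_forall_adj_isBridge.1 hS.isAcyclic hab
      rw [isBridge_iff] at hbr
      obtain ⟨e, hep, hc, hd⟩ := p.exists_boundary_dart
        {u | (S.deleteEdges {s(a, b)}).Reachable u a} (Reachable.refl _)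
        (fun h ↦ hbr (Reachable.symm h))
      have hlt := hw a b hab.ne habT p hp e hep
      have hle := hmin _ ⟨sup_le ((deleteEdges_le _).trans hSG)
        (((edge_le_iff _).2 (Or.inr e.adj)).trans hTG), hS.deleteEdges_sup_edge hc hd⟩
      rw [graphWeight_deleteEdges_sup_edge w hab e.adj.ne
        (fun h ↦ hd (h.symm.reachable.trans hc))] at hle
      have he : e.edge = s(e.fst, e.snd) := rfl
      rw [he] at hlt
      linarith
    exact hST.antisymm ((isTree_iff_minimal_connected.1 hT).2 hS.connected hST)
  obtain ⟨S, hS, hmin⟩ := Set.exists_min_image {S | IsSpanningTree G S} (graphWeight w)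
    (Set.toFinite _) ⟨T, hTG, hT⟩
  have hSmin : IsMinSpanningTree G w S := ⟨hS, hmin⟩
  obtain rfl := huniq S hSmin
  exact Set.Subset.antisymm (fun S' h ↦ huniq S' h) (by rintro _ rfl; exact hSmin)

end SpanningTree

/-! ### Flows on a tree -/

section Flow

variable {V : Type*}

/-- The vertices on the side of `c` once the edge `cd` is deleted. -/
def sideOf (T : SimpleGraph V) (c d : V) : Set V :=
  {u | (T.deleteEdges {s(c, d)}).Reachable u c}

lemma self_mem_sideOf (T : SimpleGraph V) (c d : V) : c ∈ sideOf T c d := Reachable.refl _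

lemma right_notMem_sideOf {T : SimpleGraph V} (hT : T.IsTree) {c d : V} (h : T.Adj c d) :
    d ∉ sideOf T c d := fun hd ↦
  isBridge_iff.1 (isAcyclic_iff_forall_adj_isBridge.1 hT.isAcyclic h) (Reachable.symm hd)

/-- The edge `cd` is the only one leaving the side of `c`. -/
lemma eq_of_adj_of_mem_sideOf {T : SimpleGraph V} {c d a b : V}
    (hab : T.Adj a b) (ha : a ∈ sideOf T c d) (hb : b ∉ sideOf T c d) : a = c ∧ b = d := by
  have he : s(a, b) = s(c, d) := by
    by_contra hne
    have hba : (T.deleteEdges {s(c, d)}).Adj b a := by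
      simpa [deleteEdges_adj, hab.symm, Sym2.eq_swap] using hne
    exact hb (hba.reachable.trans ha)
  rcases Sym2.eq_iff.1 he with h' | ⟨rfl, rfl⟩
  · exact h'
  · exact absurd (self_mem_sideOf T b a) hb

/-- The sides of consecutive edges of a path are nested. -/
lemma sideOf_subset_sideOf {T : SimpleGraph V} (hT : T.IsTree) {c d e : V} (hcd : T.Adj c d)
    (hce : c ≠ e) : sideOf T c d ⊆ sideOf T d e := by
  classical
  intro u hu
  obtain ⟨w, hw⟩ := reachable_deleteEdges_iff_exists_walk.1 hu
  have hd : d ∉ w.support := fun hd ↦ by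
    refine right_notMem_sideOf hT hcd (reachable_deleteEdges_iff_exists_walk.2
      ⟨w.dropUntil d hd, fun h ↦ hw (w.edges_dropUntil_subset_edges hd h)⟩)
  refine Reachable.trans (v := c) (reachable_deleteEdges_iff_exists_walk.2
    ⟨w, fun h ↦ hd (w.fst_mem_support_of_mem_edges h)⟩) (Adj.reachable ?_)
  simp only [deleteEdges_adj, hcd, Set.mem_singleton_iff, Sym2.eq_iff, true_and]
  rintro (⟨rfl, -⟩ | ⟨h, -⟩)
  · exact hcd.ne rfl
  · exact hce h

/-- The flow through the line `cd`, from `c` to `d`, that carries a unit injection at `u` to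
`root`. It is `1` or `-1` if `cd` lies on the path from `u` to `root`, and `0` otherwise. -/
noncomputable def unitFlow (T : SimpleGraph V) (root c d u : V) : ℝ :=
  (sideOf T c d).indicator 1 u - (sideOf T c d).indicator 1 root

lemma abs_unitFlow_le_one (T : SimpleGraph V) (root c d u : V) :
    |unitFlow T root c d u| ≤ 1 := by
  classical
  simp only [unitFlow, Set.indicator_apply, Pi.one_apply]
  split_ifs <;> norm_num

/-- Every line carries the injection of some vertex other than the root. -/
lemma exists_sq_unitFlow_eq_one {T : SimpleGraph V} (hT : T.IsTree) (root : V) {c d : V}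
    (h : T.Adj c d) : ∃ u ≠ root, unitFlow T root c d u ^ 2 = 1 := by
  have hc := self_mem_sideOf T c d
  have hd := right_notMem_sideOf hT h
  by_cases hr : root ∈ sideOf T c d
  · exact ⟨d, fun e ↦ hd (e ▸ hr), by simp [unitFlow, hr, hd]⟩
  · exact ⟨c, fun e ↦ hr (e ▸ hc), by simp [unitFlow, hr, hc]⟩

lemma unitFlow_mul_nonneg {T : SimpleGraph V} {root c d c' d' : V}
    (h : sideOf T c d ⊆ sideOf T c' d') (u : V) :
    0 ≤ unitFlow T root c d u * unitFlow T root c' d' u := by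
  classical
  have h1 := @h u
  have h2 := @h root
  simp only [unitFlow, Set.indicator_apply, Pi.one_apply]
  by_cases u ∈ sideOf T c d <;> by_cases root ∈ sideOf T c d <;> simp_all <;>
    split_ifs <;> norm_num

lemma sideOf_subset_of_mem_darts {T : SimpleGraph V} (hT : T.IsTree) {a c b : V} (h : T.Adj a c)
    (p : T.Walk c b) (hp : (Walk.cons h p).IsPath) : ∀ e ∈ p.darts,
      sideOf T a c ⊆ sideOf T e.fst e.snd := by
  induction p generalizing a with
  | nil => simp
  | @cons c d b h' p ih =>
    have hp' := hp
    rw [Walk.cons_isPath_iff] at hp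
    have had : a ≠ d := fun e ↦ hp.2 (by simp [e])
    have hsub := sideOf_subset_sideOf hT h had
    intro e he
    rw [Walk.darts_cons, List.mem_cons] at he
    rcases he with rfl | he
    · exact hsub
    · exact hsub.trans (ih h' hp.1 e he)

/-- Conservation of flow: an antisymmetric flow on a tree is determined by its divergence away
from the root. -/
lemma flow_eq_sum_unitFlow [Fintype V] [DecidableEq V] {T : SimpleGraph V} (hT : T.IsTree)
    (root : V) {F : V → V → ℝ} (hanti : ∀ a b, F a b = -F b a)
    (hsupp : ∀ a b, ¬ T.Adj a b → F a b = 0) {c d : V} (h : T.Adj c d) :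
    F c d = ∑ u : NonRoot root, unitFlow T root c d u * ∑ b, F u b := by
  classical
  have hzero : ∀ H : V → V → ℝ, (∀ a b, H a b = -H b a) → ∑ a, ∑ b, H a b = 0 := by
    intro H hH
    have h1 : ∑ a, ∑ b, H a b = -∑ a, ∑ b, H a b := by
      conv_lhs => rw [Finset.sum_comm]
      rw [← Finset.sum_neg_distrib]
      refine Finset.sum_congr rfl fun a _ ↦ ?_
      rw [← Finset.sum_neg_distrib]
      exact Finset.sum_congr rfl fun b _ ↦ hH b a
    linarith
  set χ : V → ℝ := (sideOf T c d).indicator 1 with hχ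
  -- Inside the side of `c` the flow cancels, so its total divergence is the flow through `cd`.
  have hside : ∑ a, χ a * ∑ b, F a b = F c d := by
    have h1 : ∑ a, χ a * ∑ b, F a b =
        ∑ a, ∑ b, χ a * χ b * F a b + ∑ a, ∑ b, χ a * (1 - χ b) * F a b := by
      rw [← Finset.sum_add_distrib]
      refine Finset.sum_congr rfl fun a _ ↦ ?_
      rw [Finset.mul_sum, ← Finset.sum_add_distrib]
      exact Finset.sum_congr rfl fun b _ ↦ by ring
    rw [h1, hzero _ (fun a b ↦ by rw [hanti a b]; ring), zero_add]
    have hcχ : χ c = 1 := by simp [hχ, self_mem_sideOf T c d]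
    have hdχ : χ d = 0 := by simp [hχ, right_notMem_sideOf hT h]
    have hval : ∀ a b, (a ≠ c ∨ b ≠ d) → χ a * (1 - χ b) * F a b = 0 := by
      intro a b hab
      by_cases hadj : T.Adj a b
      · by_cases ha : a ∈ sideOf T c d
        · by_cases hb : b ∈ sideOf T c d
          · simp [hχ, hb]
          · obtain ⟨rfl, rfl⟩ := eq_of_adj_of_mem_sideOf hadj ha hb
            simp at hab
        · simp [hχ, ha]
      · simp [hsupp a b hadj]
    rw [Finset.sum_eq_single c (fun a _ ha ↦ Finset.sum_eq_zero fun b _ ↦ hval a b (Or.inl ha))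
      (by simp), Finset.sum_eq_single d (fun b _ hb ↦ hval c b (Or.inr hb)) (by simp), hcχ, hdχ]
    ring
  have htot : ∑ a, (χ a - χ root) * ∑ b, F a b = F c d := by
    simp_rw [sub_mul, Finset.sum_sub_distrib]
    rw [hside, ← Finset.mul_sum, hzero F hanti]
    ring
  rw [← htot, ← Finset.add_sum_erase _ _ (Finset.mem_univ root), sub_self, zero_mul, zero_add]
  refine (Finset.sum_subtype _ (fun a ↦ by simp) _)

/-- The solution of the linear coupled power flow equations: the voltage drop along an operational
line is `r` times the active plus `x` times the reactive power that the line carries. -/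
lemma IsLCPF.sub_eq_sum [Fintype V] [DecidableEq V] {T : SimpleGraph V} (hT : T.IsTree) {root : V}
    {r x : Sym2 V → ℝ} {s : Injection root} {v θ : V → ℝ} (hs : IsLCPF T root r x s v θ)
    {c d : V} (h : T.Adj c d) (hr : r s(c, d) ≠ 0) :
    v c - v d = ∑ u : NonRoot root,
      (r s(c, d) * unitFlow T root c d u * s.1 u + x s(c, d) * unitFlow T root c d u * s.2 u) := by
  classical
  have hp := flow_eq_sum_unitFlow hT root (F := fun a b ↦ if T.Adj a b then
    (r s(a, b) * (v a - v b) + x s(a, b) * (θ a - θ b)) / (x s(a, b) ^ 2 + r s(a, b) ^ 2) else 0)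
    (fun a b ↦ by
      simp only [T.adj_comm a b, Sym2.eq_swap (a := a)]
      split_ifs
      · ring
      · simp) (fun a b hab ↦ by simp [hab]) h
  have hq := flow_eq_sum_unitFlow hT root (F := fun a b ↦ if T.Adj a b then
    (x s(a, b) * (v a - v b) - r s(a, b) * (θ a - θ b)) / (x s(a, b) ^ 2 + r s(a, b) ^ 2) else 0)
    (fun a b ↦ by
      simp only [T.adj_comm a b, Sym2.eq_swap (a := a)]
      split_ifs
      · ring
      · simp) (fun a b hab ↦ by simp [hab]) h
  have hp' : ∀ u : NonRoot root, s.1 u = ∑ b : V, if T.Adj u b then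
    (r s(↑u, b) * (v u - v b) + x s(↑u, b) * (θ u - θ b)) / (x s(↑u, b) ^ 2 + r s(↑u, b) ^ 2)
      else 0 := hs.active
  have hq' : ∀ u : NonRoot root, s.2 u = ∑ b : V, if T.Adj u b then
    (x s(↑u, b) * (v u - v b) - r s(↑u, b) * (θ u - θ b)) / (x s(↑u, b) ^ 2 + r s(↑u, b) ^ 2)
      else 0 := hs.reactive
  simp only [← hp', h, if_true] at hp
  simp only [← hq', h, if_true] at hq
  have hne : x s(c, d) ^ 2 + r s(c, d) ^ 2 ≠ 0 := by positivity
  simp_rw [Finset.sum_add_distrib, mul_assoc, ← Finset.mul_sum]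
  rw [← hp, ← hq]
  field_simp
  ring

end Flow

/-! ### Voltage drops along paths -/

section Path

variable {V : Type*} {T : SimpleGraph V} {a b : V}

/-- The coefficient of the injection at `u` in the voltage drop along the walk `p`: the signed sum
of the line parameter `w` (resistance or reactance) over the lines of `p` that carry it. -/
noncomputable def dropCoeff (root : V) (w : Sym2 V → ℝ) (p : T.Walk a b) (u : V) : ℝ :=
  (p.darts.map fun e ↦ w e.edge * unitFlow T root e.fst e.snd u).sum

lemma dropCoeff_cons (root : V) (w : Sym2 V → ℝ) {c : V} (h : T.Adj a c) (p : T.Walk c b) (u : V) :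
    dropCoeff root w (Walk.cons h p) u =
      w s(a, c) * unitFlow T root a c u + dropCoeff root w p u := by
  simp [dropCoeff, Dart.edge]

lemma dropCoeff_cons_nil (root : V) (w : Sym2 V → ℝ) (h : T.Adj a b) (u : V) :
    dropCoeff root w (Walk.cons h Walk.nil) u = w s(a, b) * unitFlow T root a b u := by
  simp [dropCoeff, Dart.edge]

lemma IsLCPF.sub_eq_sum_dropCoeff [Fintype V] [DecidableEq V] (hT : T.IsTree) {root : V}
    {r x : Sym2 V → ℝ} {s : Injection root} {v θ : V → ℝ} (hs : IsLCPF T root r x s v θ)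
    (hr : ∀ e ∈ T.edgeSet, 0 < r e) (p : T.Walk a b) :
    v a - v b = ∑ u : NonRoot root,
      (dropCoeff root r p u * s.1 u + dropCoeff root x p u * s.2 u) := by
  induction p with
  | nil => simp [dropCoeff]
  | @cons a c b h p ih =>
    have := hs.sub_eq_sum hT h (hr _ h).ne'
    rw [← sub_add_sub_cancel (v a) (v c), this, ih, ← Finset.sum_add_distrib]
    refine Finset.sum_congr rfl fun u _ ↦ ?_
    rw [dropCoeff_cons, dropCoeff_cons]
    ring

lemma abs_dropCoeff_le (root : V) {w : Sym2 V → ℝ} {W : ℝ}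
    (hw : ∀ e ∈ T.edgeSet, 0 < w e ∧ w e ≤ W) (p : T.Walk a b) (u : V) :
    |dropCoeff root w p u| ≤ p.length * W := by
  induction p with
  | nil => simp [dropCoeff]
  | @cons a c b h p ih =>
    rw [dropCoeff_cons, Walk.length_cons]
    refine (abs_add_le _ _).trans ?_
    have h1 : |w s(a, c) * unitFlow T root a c u| ≤ W := by
      obtain ⟨h0, hW⟩ := hw _ ((mem_edgeSet T).2 h)
      rw [abs_mul, abs_of_pos h0]
      exact (mul_le_of_le_one_right h0.le (abs_unitFlow_le_one _ _ _ _ _)).trans hW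
    push_cast
    linarith

/-- The power of one injection flows in the same direction along all the lines of a path. -/
lemma unitFlow_mul_dropCoeff_nonneg (hT : T.IsTree) (root : V) {w : Sym2 V → ℝ}
    (hw : ∀ e ∈ T.edgeSet, 0 < w e) {c : V} (h : T.Adj a c) (p : T.Walk c b)
    (hp : (Walk.cons h p).IsPath) (u : V) :
    0 ≤ unitFlow T root a c u * dropCoeff root w p u := by
  rw [dropCoeff, ← List.sum_map_mul_left]
  refine List.sum_nonneg fun y hy ↦ ?_
  obtain ⟨e, he, rfl⟩ := List.mem_map.1 hy
  rw [mul_left_comm]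
  exact mul_nonneg (hw _ e.edge_mem).le
    (unitFlow_mul_nonneg (sideOf_subset_of_mem_darts hT h p hp e he) u)

/-- The variance of the voltage drop along `p`, when the injections at different buses are
uncorrelated, and those at bus `u` have variances `Vp u`, `Vq u` and covariance `K u`. -/
noncomputable def dropVar [Fintype V] [DecidableEq V] {root : V} (r x : Sym2 V → ℝ)
    (Vp Vq K : NonRoot root → ℝ) (p : T.Walk a b) : ℝ :=
  ∑ u : NonRoot root, (dropCoeff root r p u ^ 2 * Vp u + dropCoeff root x p u ^ 2 * Vq u +
    2 * (dropCoeff root r p u * dropCoeff root x p u) * K u)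

variable [Fintype V] [DecidableEq V] {root : V} {r x : Sym2 V → ℝ} {Vp Vq K : NonRoot root → ℝ}

/-- Superadditivity of the variance of the voltage drop along a path, which holds because no
injection contributes to the drops along two lines of a path with opposite signs. -/
lemma sum_dropVar_le_dropVar (hT : T.IsTree) (hr : ∀ e ∈ T.edgeSet, 0 < r e)
    (hx : ∀ e ∈ T.edgeSet, 0 < x e) (hVp : ∀ u, 0 ≤ Vp u) (hVq : ∀ u, 0 ≤ Vq u)
    (hK : ∀ u, 0 ≤ K u) (p : T.Walk a b) (hp : p.IsPath) :
    (p.darts.map fun e ↦ dropVar r x Vp Vq K (Walk.cons e.adj Walk.nil)).sum ≤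
      dropVar r x Vp Vq K p := by
  induction p with
  | nil => simp [dropVar, dropCoeff]
  | @cons a c b h p ih =>
    have ih := ih ((Walk.cons_isPath_iff h p).1 hp).1
    rw [Walk.darts_cons, List.map_cons, List.sum_cons]
    refine (add_le_add_right ih _).trans ?_
    change dropVar r x Vp Vq K (Walk.cons h Walk.nil) + dropVar r x Vp Vq K p ≤ _
    simp only [dropVar, ← Finset.sum_add_distrib]
    refine Finset.sum_le_sum fun u _ ↦ ?_
    simp only [dropCoeff_cons_nil root _ h, dropCoeff_cons root _ h p]
    have h1 := unitFlow_mul_dropCoeff_nonneg hT root hr h p hp u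
    have h2 := unitFlow_mul_dropCoeff_nonneg hT root hx h p hp u
    have hr0 := (hr _ ((mem_edgeSet T).2 h)).le
    have hx0 := (hx _ ((mem_edgeSet T).2 h)).le
    have i1 := mul_nonneg (mul_nonneg hr0 h1) (hVp u)
    have i2 := mul_nonneg (mul_nonneg hx0 h2) (hVq u)
    have i3 := mul_nonneg (mul_nonneg hx0 h1) (hK u)
    have i4 := mul_nonneg (mul_nonneg hr0 h2) (hK u)
    linarith

/-- A uniform lower bound on the variance of the voltage drop along a single line. -/
lemma le_dropVar_cons_nil (hT : T.IsTree) {m σ : ℝ} (hm : 0 < m)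
    (hr : ∀ e ∈ T.edgeSet, m ≤ r e) (hx : ∀ e ∈ T.edgeSet, m ≤ x e)
    (hVp : ∀ u, 0 ≤ Vp u) (hVq : ∀ u, 0 ≤ Vq u) (hK : ∀ u, 0 ≤ K u)
    (hσ : ∀ u, σ ≤ Vp u + Vq u) (h : T.Adj a b) :
    m ^ 2 * σ ≤ dropVar r x Vp Vq K (Walk.cons h Walk.nil) := by
  have hr' := hr _ ((mem_edgeSet T).2 h)
  have hx' := hx _ ((mem_edgeSet T).2 h)
  have hr0 := hm.trans_le hr'
  have hx0 := hm.trans_le hx'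
  have heq : ∀ u : NonRoot root, dropCoeff root r (Walk.cons h Walk.nil) u ^ 2 * Vp u +
      dropCoeff root x (Walk.cons h Walk.nil) u ^ 2 * Vq u +
      2 * (dropCoeff root r (Walk.cons h Walk.nil) u *
        dropCoeff root x (Walk.cons h Walk.nil) u) * K u =
      unitFlow T root a b u ^ 2 * (r s(a, b) ^ 2 * Vp u + x s(a, b) ^ 2 * Vq u +
        2 * (r s(a, b) * x s(a, b)) * K u) := fun u ↦ by
    simp only [dropCoeff_cons_nil]
    ring
  have hnn : ∀ u : NonRoot root, 0 ≤ r s(a, b) ^ 2 * Vp u + x s(a, b) ^ 2 * Vq u +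
      2 * (r s(a, b) * x s(a, b)) * K u := fun u ↦ by
    have := hVp u; have := hVq u; have := hK u
    positivity
  obtain ⟨u, hu, hu1⟩ := exists_sq_unitFlow_eq_one hT root h
  rw [dropVar]
  refine le_trans ?_ (Finset.single_le_sum (fun u _ ↦ by
    rw [heq]; exact mul_nonneg (sq_nonneg _) (hnn u)) (Finset.mem_univ (⟨u, hu⟩ : NonRoot root)))
  rw [heq, hu1, one_mul]
  have i1 : m ^ 2 * Vp ⟨u, hu⟩ ≤ r s(a, b) ^ 2 * Vp ⟨u, hu⟩ :=
    mul_le_mul_of_nonneg_right (by gcongr) (hVp _)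
  have i2 : m ^ 2 * Vq ⟨u, hu⟩ ≤ x s(a, b) ^ 2 * Vq ⟨u, hu⟩ :=
    mul_le_mul_of_nonneg_right (by gcongr) (hVq _)
  have i3 : 0 ≤ 2 * (r s(a, b) * x s(a, b)) * K ⟨u, hu⟩ :=
    mul_nonneg (by positivity) (hK _)
  have i4 : m ^ 2 * σ ≤ m ^ 2 * (Vp ⟨u, hu⟩ + Vq ⟨u, hu⟩) :=
    mul_le_mul_of_nonneg_left (hσ _) (by positivity)
  linarith

lemma List.add_le_sum_of_mem {ι : Type*} {l : List ι} {f : ι → ℝ} {γ : ℝ} (hγ : 0 ≤ γ)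
    (hf : ∀ i ∈ l, γ ≤ f i) (hl : 2 ≤ l.length) {i : ι} (hi : i ∈ l) :
    f i + γ ≤ (l.map f).sum := by
  classical
  rw [((List.perm_cons_erase hi).map f).sum_eq, List.map_cons, List.sum_cons]
  have hlen : 0 < (l.erase i).length := by rw [List.length_erase_of_mem hi]; omega
  obtain ⟨j, hj⟩ := List.exists_mem_of_length_pos hlen
  have h1 : f j ≤ ((l.erase i).map f).sum :=
    List.single_le_sum (fun y hy ↦ by
      obtain ⟨k, hk, rfl⟩ := List.mem_map.1 hy
      exact hγ.trans (hf k (List.mem_of_mem_erase hk))) _ (List.mem_map_of_mem hj)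
  linarith [hf j (List.mem_of_mem_erase hj)]

/-- The gap between the variance of the voltage difference of two buses not joined by an operational
line, and the one along an operational line between them. -/
theorem dropVar_cons_nil_add_le (hT : T.IsTree) {m σ : ℝ} (hm : 0 < m) (hσ0 : 0 ≤ σ)
    (hr : ∀ e ∈ T.edgeSet, m ≤ r e) (hx : ∀ e ∈ T.edgeSet, m ≤ x e)
    (hVp : ∀ u, 0 ≤ Vp u) (hVq : ∀ u, 0 ≤ Vq u) (hK : ∀ u, 0 ≤ K u)
    (hσ : ∀ u, σ ≤ Vp u + Vq u) {p : T.Walk a b} (hp : p.IsPath) (hab : a ≠ b)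
    (hadj : ¬ T.Adj a b) {e : T.Dart} (he : e ∈ p.darts) :
    dropVar r x Vp Vq K (Walk.cons e.adj Walk.nil) + m ^ 2 * σ ≤ dropVar r x Vp Vq K p := by
  refine le_trans ?_ (sum_dropVar_le_dropVar hT (fun e h ↦ hm.trans_le (hr e h))
    (fun e h ↦ hm.trans_le (hx e h)) hVp hVq hK p hp)
  refine List.add_le_sum_of_mem (f := fun e : T.Dart ↦
    dropVar r x Vp Vq K (Walk.cons e.adj Walk.nil)) (by positivity)
    (fun e _ ↦ le_dropVar_cons_nil hT hm hr hx hVp hVq hK hσ e.adj) ?_ he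
  rw [Walk.length_darts]
  match p, hab, hadj with
  | .nil, hab, _ => exact absurd rfl hab
  | .cons h .nil, _, hadj => exact absurd h hadj
  | .cons _ (.cons _ _), _, _ => simp

/-- The variance of the voltage drop along a path of length `l` is `O(l ^ 2 * |V|)`. -/
lemma dropVar_le {R X M : ℝ} (hr : ∀ e ∈ T.edgeSet, 0 < r e ∧ r e ≤ R)
    (hx : ∀ e ∈ T.edgeSet, 0 < x e ∧ x e ≤ X) (hM : 0 ≤ M) (hVp : ∀ u, Vp u ≤ M)
    (hVq : ∀ u, Vq u ≤ M) (hK : ∀ u, 0 ≤ K u) (hKM : ∀ u, K u ≤ M) (p : T.Walk a b) :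
    dropVar r x Vp Vq K p ≤
      2 * M * (R ^ 2 + X ^ 2) * (p.length : ℝ) ^ 2 * Fintype.card V := by
  have hcard : (Fintype.card (NonRoot root) : ℝ) ≤ Fintype.card V := by
    exact_mod_cast Fintype.card_subtype_le _
  rw [dropVar]
  refine (Finset.sum_le_card_nsmul _ _ (2 * M * (R ^ 2 + X ^ 2) * (p.length : ℝ) ^ 2)
    fun u _ ↦ ?_).trans ?_
  · have h1 : dropCoeff root r p u ^ 2 ≤ (p.length * R) ^ 2 :=
      sq_le_sq' (abs_le.1 (abs_dropCoeff_le root hr p u)).1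
        (abs_le.1 (abs_dropCoeff_le root hr p u)).2
    have h2 : dropCoeff root x p u ^ 2 ≤ (p.length * X) ^ 2 :=
      sq_le_sq' (abs_le.1 (abs_dropCoeff_le root hx p u)).1
        (abs_le.1 (abs_dropCoeff_le root hx p u)).2
    set α := dropCoeff root r p u
    set β := dropCoeff root x p u
    have i1 : α ^ 2 * Vp u ≤ α ^ 2 * M := by gcongr; exact hVp u
    have i2 : β ^ 2 * Vq u ≤ β ^ 2 * M := by gcongr; exact hVq u
    have i3 : 2 * (α * β) * K u ≤ (α ^ 2 + β ^ 2) * K u :=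
      mul_le_mul_of_nonneg_right (by nlinarith [sq_nonneg (α - β)]) (hK u)
    have i4 : (α ^ 2 + β ^ 2) * K u ≤ (α ^ 2 + β ^ 2) * M := by gcongr; exact hKM u
    have i5 : 2 * M * (α ^ 2 + β ^ 2) ≤ 2 * M * ((p.length * R) ^ 2 + (p.length * X) ^ 2) := by
      gcongr
    linarith
  · rw [Finset.card_univ, nsmul_eq_mul, mul_comm]
    gcongr

end Path

/-- Paths of a rooted tree are at most twice as long as the tree is deep. -/
lemma SimpleGraph.Walk.IsPath.length_le_two_mul_treeDepth {V : Type*} [Fintype V]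
    {T : SimpleGraph V} (hT : T.IsTree) (root : V) {a b : V} {p : T.Walk a b} (hp : p.IsPath) :
    p.length ≤ 2 * treeDepth T root := by
  obtain ⟨q, hq, hlen⟩ := hT.connected.exists_path_of_dist a b
  have hpq : p = q := (hT.existsUnique_path a b).unique hp hq
  have ha : T.dist root a ≤ treeDepth T root :=
    Finset.le_sup (f := fun a ↦ T.dist root a) (Finset.mem_univ a)
  have hb : T.dist root b ≤ treeDepth T root :=
    Finset.le_sup (f := fun a ↦ T.dist root a) (Finset.mem_univ b)
  have htri := hT.connected.dist_triangle (u := a) (v := root) (w := b)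
  rw [T.dist_comm (u := a) (v := root)] at htri
  rw [hpq, hlen]
  omega

/-! ### Concentration of the empirical variance -/

lemma Real.exp_neg_sub_sq_le_one_sub {x : ℝ} (hx : |x| ≤ 1 / 2) :
    Real.exp (-x - x ^ 2) ≤ 1 - x := by
  obtain ⟨h1, h2⟩ := abs_le.1 hx
  have hpos : 0 < 1 - x := by linarith
  rw [show -x - x ^ 2 = -(x + x ^ 2) by ring, Real.exp_neg]
  refine inv_le_of_inv_le₀ hpos ?_
  rw [inv_eq_one_div, div_le_iff₀ hpos]
  rcases le_total 0 x with h0 | h0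
  · have := Real.quadratic_le_exp_of_nonneg (show 0 ≤ x + x ^ 2 by positivity)
    have h3 : 1 ≤ (1 + (x + x ^ 2) + (x + x ^ 2) ^ 2 / 2) * (1 - x) := by
      have : 0 ≤ x ^ 2 * ((1 + x) * (1 - x ^ 2) / 2 - x) := by
        apply mul_nonneg (sq_nonneg x)
        nlinarith [mul_nonneg h0 (sub_nonneg.2 h2), mul_nonneg h0 h0,
          mul_nonneg (mul_nonneg h0 (sub_nonneg.2 h2)) h0]
      nlinarith
    exact h3.trans (mul_le_mul_of_nonneg_right this hpos.le)
  · have := Real.add_one_le_exp (x + x ^ 2)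
    have h3 : 1 ≤ (x + x ^ 2 + 1) * (1 - x) := by
      nlinarith [mul_nonneg (sq_nonneg x) (neg_nonneg.2 h0)]
    exact h3.trans (mul_le_mul_of_nonneg_right this hpos.le)

/-- The density of a centred Gaussian times `exp (t * x ^ 2)` is an unnormalised Gaussian. -/
lemma gaussianPDFReal_zero_mul_exp_mul_sq {φ : NNReal} (hφ : φ ≠ 0) (t x : ℝ) :
    gaussianPDFReal 0 φ x * Real.exp (t * x ^ 2) =
      (√(2 * Real.pi * φ))⁻¹ * Real.exp (-((1 - 2 * t * φ) / (2 * φ)) * x ^ 2) := by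
  have hφ' : (φ : ℝ) ≠ 0 := by exact_mod_cast hφ
  rw [gaussianPDFReal, mul_assoc, ← Real.exp_add]
  congr 2
  field_simp
  ring

lemma integrable_exp_mul_sq_gaussianReal {φ : NNReal} {t : ℝ} (ht : 2 * t * φ < 1) :
    Integrable (fun x ↦ Real.exp (t * x ^ 2)) (gaussianReal 0 φ) := by
  by_cases hφ : φ = 0
  · subst hφ
    simp [integrable_dirac]
  have hφ' : (0 : ℝ) < φ := by exact_mod_cast pos_iff_ne_zero.2 hφ
  rw [gaussianReal_of_var_ne_zero _ hφ,
    integrable_withDensity_iff_integrable_smul' (measurable_gaussianPDF _ _)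
      (ae_of_all _ fun _ ↦ gaussianPDF_lt_top)]
  simp only [toReal_gaussianPDF, smul_eq_mul, gaussianPDFReal_zero_mul_exp_mul_sq hφ]
  refine (integrable_exp_neg_mul_sq ?_).const_mul _
  have : 0 < 1 - 2 * t * φ := by linarith
  positivity

/-- The moment generating function of the square of a centred Gaussian variable. -/
lemma integral_exp_mul_sq_gaussianReal {φ : NNReal} {t : ℝ} (ht : 2 * t * φ < 1) :
    ∫ x, Real.exp (t * x ^ 2) ∂(gaussianReal 0 φ) = (√(1 - 2 * t * φ))⁻¹ := by
  by_cases hφ : φ = 0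
  · subst hφ
    simp
  have hφ' : (0 : ℝ) < φ := by exact_mod_cast pos_iff_ne_zero.2 hφ
  have h1 : 0 < 1 - 2 * t * φ := by linarith
  rw [integral_gaussianReal_eq_integral_smul hφ]
  simp only [smul_eq_mul, gaussianPDFReal_zero_mul_exp_mul_sq hφ]
  rw [integral_const_mul, integral_gaussian, ← Real.sqrt_inv, ← Real.sqrt_inv,
    ← Real.sqrt_mul (by positivity)]
  congr 1
  field_simp

lemma integral_exp_mul_sq_gaussianReal_le {φ : NNReal} {t : ℝ} (ht : |2 * t * φ| ≤ 1 / 2) :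
    ∫ x, Real.exp (t * x ^ 2) ∂(gaussianReal 0 φ) ≤
      Real.exp (t * φ + 2 * t ^ 2 * φ ^ 2) := by
  have h1 : 2 * t * φ < 1 := by linarith [(abs_le.1 ht).2]
  rw [integral_exp_mul_sq_gaussianReal h1]
  have h2 := Real.exp_neg_sub_sq_le_one_sub ht
  have h3 : Real.exp (-(t * φ + 2 * t ^ 2 * φ ^ 2)) ≤ √(1 - 2 * t * φ) := by
    apply Real.le_sqrt_of_sq_le
    rw [← Real.exp_nat_mul]
    convert h2 using 2
    push_cast
    ring
  calc (√(1 - 2 * t * φ))⁻¹ ≤ (Real.exp (-(t * φ + 2 * t ^ 2 * φ ^ 2)))⁻¹ := by gcongr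
    _ = _ := by rw [Real.exp_neg, inv_inv]

section Chernoff

variable {Ω : Type*} [MeasurableSpace Ω] {P : Measure Ω} {n : ℕ} {Z : Fin n → Ω → ℝ} {φ : NNReal}

lemma mgf_sum_sq_le (hZ : ∀ k, HasLaw (Z k) (gaussianReal 0 φ) P) (hind : iIndepFun Z P)
    {t : ℝ} (ht : |2 * t * φ| ≤ 1 / 2) :
    mgf (∑ k, fun ω ↦ Z k ω ^ 2) P t ≤ Real.exp (n * (t * φ + 2 * t ^ 2 * φ ^ 2)) := by
  have hind2 : iIndepFun (fun k ω ↦ Z k ω ^ 2) P :=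
    hind.comp (fun _ x ↦ x ^ 2) (fun _ ↦ by fun_prop)
  have hm : ∀ k, AEMeasurable (fun ω ↦ Z k ω ^ 2) P := fun k ↦ (hZ k).aemeasurable.pow_const 2
  have hk : ∀ k, mgf (fun ω ↦ Z k ω ^ 2) P t ≤ Real.exp (t * φ + 2 * t ^ 2 * φ ^ 2) := fun k ↦ by
    have h := (hZ k).integral_comp (f := fun x ↦ Real.exp (t * x ^ 2))
      (by fun_prop : Measurable fun x : ℝ ↦ Real.exp (t * x ^ 2)).aestronglyMeasurable
    simp only [mgf]
    exact h.trans_le (integral_exp_mul_sq_gaussianReal_le ht)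
  rw [hind2.mgf_sum₀ hm, Real.exp_nat_mul]
  calc ∏ k, mgf (fun ω ↦ Z k ω ^ 2) P t ≤ ∏ _k : Fin n, Real.exp (t * φ + 2 * t ^ 2 * φ ^ 2) :=
        Finset.prod_le_prod (fun _ _ ↦ mgf_nonneg) fun k _ ↦ hk k
    _ = _ := by simp

lemma integrable_exp_mul_sum_sq (hZ : ∀ k, HasLaw (Z k) (gaussianReal 0 φ) P)
    (hind : iIndepFun Z P) {t : ℝ} (ht : |2 * t * φ| ≤ 1 / 2) :
    Integrable (fun ω ↦ Real.exp (t * (∑ k, fun ω ↦ Z k ω ^ 2) ω)) P := by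
  have := hind.isProbabilityMeasure
  have hind2 : iIndepFun (fun k ω ↦ Z k ω ^ 2) P :=
    hind.comp (fun _ x ↦ x ^ 2) (fun _ ↦ by fun_prop)
  have hm : ∀ k, AEMeasurable (fun ω ↦ Z k ω ^ 2) P := fun k ↦ (hZ k).aemeasurable.pow_const 2
  have hint : ∀ k, Integrable (fun ω ↦ Real.exp (t * Z k ω ^ 2)) P := fun k ↦ by
    have h := integrable_exp_mul_sq_gaussianReal (φ := φ) (t := t)
      (by linarith [(abs_le.1 ht).2])
    rw [← (hZ k).map_eq] at h
    exact h.comp_aemeasurable (hZ k).aemeasurable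
  -- A function whose Bochner integral is nonzero is integrable.
  refine Integrable.of_integral_ne_zero ?_
  change mgf (∑ k, fun ω ↦ Z k ω ^ 2) P t ≠ 0
  rw [hind2.mgf_sum₀ hm]
  exact Finset.prod_ne_zero_iff.2 fun k _ ↦ (mgf_pos (hint k)).ne'

/-- Concentration of the empirical second moment of a centred Gaussian variable. -/
theorem measureReal_abs_sum_sq_div_sub_ge_le
    (hZ : ∀ k, HasLaw (Z k) (gaussianReal 0 φ) P) (hind : iIndepFun Z P) (hn : 0 < n)
    {B ε : ℝ} (hφ : φ ≤ B) (hε : 0 < ε) (hεB : ε ≤ B) :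
    P.real {ω | ε ≤ |(∑ k, Z k ω ^ 2) / n - φ|} ≤
      2 * Real.exp (-(n * ε ^ 2 / (8 * B ^ 2))) := by
  have := hind.isProbabilityMeasure
  have hB : 0 < B := hε.trans_le hεB
  have hn' : (0 : ℝ) < n := by exact_mod_cast hn
  set t : ℝ := ε / (4 * B ^ 2) with ht_def
  have ht0 : 0 < t := by positivity
  have hφ0 : (0 : ℝ) ≤ φ := φ.2
  have htφ : 2 * t * φ ≤ 1 / 2 := by
    calc 2 * t * φ ≤ 2 * (B / (4 * B ^ 2)) * B := by rw [ht_def]; gcongr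
      _ = 1 / 2 := by field_simp; norm_num
  have habs : |2 * t * φ| ≤ 1 / 2 := by rwa [abs_of_nonneg (by positivity)]
  have habs' : |2 * (-t) * φ| ≤ 1 / 2 := by
    rwa [show 2 * (-t) * (φ : ℝ) = -(2 * t * φ) by ring, abs_neg]
  have hsq : 2 * t ^ 2 * φ ^ 2 ≤ 2 * t ^ 2 * B ^ 2 := by gcongr
  have hopt : -t * ε + 2 * t ^ 2 * B ^ 2 = -(ε ^ 2 / (8 * B ^ 2)) := by
    rw [ht_def]; field_simp; ring
  have hup : P.real {ω | n * (φ + ε) ≤ (∑ k, fun ω ↦ Z k ω ^ 2) ω} ≤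
      Real.exp (-(n * ε ^ 2 / (8 * B ^ 2))) := by
    refine (measure_ge_le_exp_mul_mgf _ ht0.le (integrable_exp_mul_sum_sq hZ hind habs)).trans ?_
    refine (mul_le_mul_of_nonneg_left (mgf_sum_sq_le hZ hind habs) (Real.exp_nonneg _)).trans ?_
    rw [← Real.exp_add, Real.exp_le_exp]
    have : (n : ℝ) * (-t * ε + 2 * t ^ 2 * φ ^ 2) ≤ n * -(ε ^ 2 / (8 * B ^ 2)) := by
      rw [← hopt]; gcongr
    linarith [mul_div_assoc (n : ℝ) (ε ^ 2) (8 * B ^ 2)]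
  have hlo : P.real {ω | (∑ k, fun ω ↦ Z k ω ^ 2) ω ≤ n * (φ - ε)} ≤
      Real.exp (-(n * ε ^ 2 / (8 * B ^ 2))) := by
    refine (measure_le_le_exp_mul_mgf _ (neg_nonpos.2 ht0.le)
      (integrable_exp_mul_sum_sq hZ hind habs')).trans ?_
    refine (mul_le_mul_of_nonneg_left (mgf_sum_sq_le hZ hind habs') (Real.exp_nonneg _)).trans ?_
    rw [← Real.exp_add, Real.exp_le_exp]
    have : (n : ℝ) * (-t * ε + 2 * t ^ 2 * φ ^ 2) ≤ n * -(ε ^ 2 / (8 * B ^ 2)) := by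
      rw [← hopt]; gcongr
    linarith [mul_div_assoc (n : ℝ) (ε ^ 2) (8 * B ^ 2)]
  have hsub : {ω | ε ≤ |(∑ k, Z k ω ^ 2) / n - φ|} ⊆
      {ω | n * (φ + ε) ≤ (∑ k, fun ω ↦ Z k ω ^ 2) ω} ∪
        {ω | (∑ k, fun ω ↦ Z k ω ^ 2) ω ≤ n * (φ - ε)} := by
    intro ω hω
    simp only [Set.mem_ofPred_eq, Set.mem_union, Finset.sum_apply] at hω ⊢
    rcases le_abs.1 hω with h | h
    · left
      have : φ + ε ≤ (∑ k, Z k ω ^ 2) / n := by linarith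
      rw [le_div_iff₀ hn'] at this
      linarith
    · right
      have : (∑ k, Z k ω ^ 2) / n ≤ φ - ε := by linarith
      rw [div_le_iff₀ hn'] at this
      linarith
  calc _ ≤ _ := measureReal_mono hsub
    _ ≤ _ := measureReal_union_le _ _
    _ ≤ _ := by linarith

end Chernoff

/-! ### Recovery of the tree from the samples -/

section InjectionLaw

variable {V : Type*} [Fintype V] [DecidableEq V] {root : V} {μ : Measure (Injection root)}

lemma IsInjectionLaw.memLp_fst (hμ : IsInjectionLaw μ) (u : NonRoot root) :
    MemLp (fun s : Injection root ↦ s.1 u) 2 μ := by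
  have := hμ.gaussian
  exact IsGaussian.memLp_dual μ ((ContinuousLinearMap.proj u).comp
    (ContinuousLinearMap.fst ℝ (NonRoot root → ℝ) (NonRoot root → ℝ))) 2 (by simp)

lemma IsInjectionLaw.memLp_snd (hμ : IsInjectionLaw μ) (u : NonRoot root) :
    MemLp (fun s : Injection root ↦ s.2 u) 2 μ := by
  have := hμ.gaussian
  exact IsGaussian.memLp_dual μ ((ContinuousLinearMap.proj u).comp
    (ContinuousLinearMap.snd ℝ (NonRoot root → ℝ) (NonRoot root → ℝ))) 2 (by simp)

lemma IsInjectionLaw.variance_sum (hμ : IsInjectionLaw μ) (α β : NonRoot root → ℝ) :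
    Var[fun s ↦ ∑ u, (α u * s.1 u + β u * s.2 u); μ] =
      ∑ u, (α u ^ 2 * Var[fun s ↦ s.1 u; μ] + β u ^ 2 * Var[fun s ↦ s.2 u; μ] +
        2 * (α u * β u) * cov[fun s ↦ s.2 u, fun s ↦ s.1 u; μ]) := by
  have := hμ.gaussian
  have hP := fun u ↦ (hμ.memLp_fst u).const_mul (α u)
  have hQ := fun u ↦ (hμ.memLp_snd u).const_mul (β u)
  have hPQ : ∀ u, MemLp (fun s : Injection root ↦ α u * s.1 u + β u * s.2 u) 2 μ :=
    fun u ↦ (hP u).add (hQ u)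
  have hterm : ∀ u w, cov[fun s ↦ α u * s.1 u + β u * s.2 u,
      fun s ↦ α w * s.1 w + β w * s.2 w; μ] =
      α u * (α w * cov[fun s ↦ s.1 u, fun s ↦ s.1 w; μ]) +
      α u * (β w * cov[fun s ↦ s.2 w, fun s ↦ s.1 u; μ]) +
      (β u * (α w * cov[fun s ↦ s.2 u, fun s ↦ s.1 w; μ]) +
      β u * (β w * cov[fun s ↦ s.2 u, fun s ↦ s.2 w; μ])) := by
    intro u w
    change cov[(fun s : Injection root ↦ α u * s.1 u) + fun s ↦ β u * s.2 u,
      (fun s : Injection root ↦ α w * s.1 w) + fun s ↦ β w * s.2 w; μ] = _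
    rw [covariance_add_left (hP u) (hQ u) ((hP w).add (hQ w)),
      covariance_add_right (hP u) (hP w) (hQ w), covariance_add_right (hQ u) (hP w) (hQ w)]
    simp only [covariance_const_mul_left, covariance_const_mul_right]
    rw [covariance_comm (fun s : Injection root ↦ s.1 u) (fun s : Injection root ↦ s.2 w)]
    ring
  have hL : MemLp (fun s : Injection root ↦ ∑ u, (α u * s.1 u + β u * s.2 u)) 2 μ :=
    memLp_finsetSum _ fun u _ ↦ hPQ u
  rw [← covariance_self hL.aemeasurable, covariance_fun_sum_fun_sum hPQ hPQ]
  refine Finset.sum_congr rfl fun u _ ↦ ?_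
  rw [Finset.sum_eq_single u]
  · rw [hterm, covariance_self (hμ.memLp_fst u).aemeasurable,
      covariance_self (hμ.memLp_snd u).aemeasurable]
    ring
  · intro w _ hwu
    rw [hterm, hμ.cov_p _ _ hwu.symm, hμ.cov_q _ _ hwu.symm, hμ.cov_qp _ _ hwu.symm,
      hμ.cov_qp _ _ hwu]
    ring
  · simp

lemma IsInjectionLaw.map_sum_eq_gaussianReal (hμ : IsInjectionLaw μ) (α β : NonRoot root → ℝ) :
    μ.map (fun s ↦ ∑ u, (α u * s.1 u + β u * s.2 u)) =
      gaussianReal 0 (Var[fun s ↦ ∑ u, (α u * s.1 u + β u * s.2 u); μ]).toNNReal := by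
  have := hμ.gaussian
  let L : StrongDual ℝ (Injection root) := ∑ u, (α u • (ContinuousLinearMap.proj u).comp
    (ContinuousLinearMap.fst ℝ (NonRoot root → ℝ) (NonRoot root → ℝ)) +
    β u • (ContinuousLinearMap.proj u).comp
    (ContinuousLinearMap.snd ℝ (NonRoot root → ℝ) (NonRoot root → ℝ)))
  have hL : (L : Injection root → ℝ) = fun s ↦ ∑ u, (α u * s.1 u + β u * s.2 u) := by
    ext s
    simp [L]
  have hmean : ∫ s, L s ∂μ = 0 := by
    have hP := fun u ↦ ((hμ.memLp_fst u).integrable one_le_two).const_mul (α u)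
    have hQ := fun u ↦ ((hμ.memLp_snd u).integrable one_le_two).const_mul (β u)
    have hPQ : ∀ u, Integrable (fun s : Injection root ↦ α u * s.1 u + β u * s.2 u) μ :=
      fun u ↦ (hP u).add (hQ u)
    rw [hL, integral_finsetSum _ fun u _ ↦ hPQ u]
    refine Finset.sum_eq_zero fun u _ ↦ ?_
    rw [integral_add (hP u) (hQ u), integral_const_mul, integral_const_mul, hμ.mean_p, hμ.mean_q]
    simp
  rw [← hL, IsGaussian.map_eq_gaussianReal L, hmean]

lemma IsInjectionLaw.covariance_le (hμ : IsInjectionLaw μ) {M : ℝ} {u : NonRoot root}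
    (hp : Var[fun s ↦ s.1 u; μ] ≤ M) (hq : Var[fun s ↦ s.2 u; μ] ≤ M) :
    cov[fun s ↦ s.2 u, fun s ↦ s.1 u; μ] ≤ M := by
  have := hμ.gaussian
  have h := variance_fun_sub (hμ.memLp_snd u) (hμ.memLp_fst u)
  have h0 := variance_nonneg (fun s : Injection root ↦ s.2 u - s.1 u) μ
  linarith

end InjectionLaw

/-- If every pair not joined in the tree outweighs, by the gap `γ`, each edge of the tree path
between its ends, and the estimated weights are off by less than `γ / 2`, then the estimated weights
determine the tree. -/
lemma mstOutputs_eq_singleton {V : Type*} [Fintype V] {n : ℕ} {G T : SimpleGraph V}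
    (hT : T.IsTree) (hTG : T ≤ G) {v : Fin n → V → ℝ} {φ : V → V → ℝ} {γ : ℝ}
    (hgap : ∀ a b, a ≠ b → ¬ T.Adj a b → ∀ p : T.Walk a b, p.IsPath → ∀ e ∈ p.darts,
      φ e.fst e.snd + γ ≤ φ a b)
    (hv : ∀ a b, |(∑ k, (v k a - v k b) ^ 2) / n - φ a b| < γ / 2) :
    mstOutputs G v = {T} := by
  refine setOf_isMinSpanningTree_eq_singleton _ hT hTG fun a b hab hadj p hp e he ↦ ?_
  have h1 := hgap a b hab hadj p hp e he
  have h2 := abs_lt.1 (hv a b)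
  have h3 := abs_lt.1 (hv e.fst e.snd)
  change (∑ k, (v k e.fst - v k e.snd) ^ 2) / (n : ℝ) < (∑ k, (v k a - v k b) ^ 2) / (n : ℝ)
  linarith

/-- The sample size that makes the union bound over all pairs of buses work. -/
lemma card_sq_mul_two_mul_exp_le {N n η γ D K : ℝ} (hN : 2 ≤ N) (hη : 0 < η) (hη1 : η < 1)
    (hγ : 0 < γ) (hD : 0 < D) (hK : 0 < K)
    (hn : 96 * K ^ 2 / γ ^ 2 * D ^ 4 * N ^ 2 * Real.log (N / η) < n) :
    N * N * (2 * Real.exp (-(n * (γ / 2) ^ 2 / (8 * (K * D ^ 2 * N) ^ 2)))) ≤ η := by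
  have hN0 : 0 < N := by linarith
  have h1 : 3 * Real.log (N / η) ≤ n * (γ / 2) ^ 2 / (8 * (K * D ^ 2 * N) ^ 2) := by
    rw [le_div_iff₀ (by positivity)]
    calc 3 * Real.log (N / η) * (8 * (K * D ^ 2 * N) ^ 2)
        = 96 * K ^ 2 / γ ^ 2 * D ^ 4 * N ^ 2 * Real.log (N / η) * (γ / 2) ^ 2 := by
          field_simp; ring
      _ ≤ n * (γ / 2) ^ 2 := by gcongr
  have h2 : Real.exp (-(3 * Real.log (N / η))) = (η / N) ^ 3 := by
    rw [show -(3 * Real.log (N / η)) = (3 : ℕ) * Real.log (η / N) by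
      rw [← inv_div, Real.log_inv]; push_cast; ring, Real.exp_nat_mul,
      Real.exp_log (by positivity)]
  have h3 : Real.exp (-(n * (γ / 2) ^ 2 / (8 * (K * D ^ 2 * N) ^ 2))) ≤ (η / N) ^ 3 := by
    rw [← h2]
    gcongr
  calc N * N * (2 * Real.exp (-(n * (γ / 2) ^ 2 / (8 * (K * D ^ 2 * N) ^ 2))))
      ≤ N * N * (2 * (η / N) ^ 3) := by gcongr
    _ = η * (η * η * (2 / N)) := by field_simp
    _ ≤ η * (1 * 1 * 1) := by
        gcongr
        exact (div_le_one hN0).2 hN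
    _ = η := by ring

theorem theorem3 (rmin rmax xmin xmax varmin varmax : ℝ)
    (hrmin : 0 < rmin) (hxmin : 0 < xmin) (hvarmin : 0 < varmin) :
    ∃ C : ℝ, 0 < C ∧
      ∀ (V : Type*) [Fintype V] (root : V) (T Efull : SimpleGraph V) (r x : Sym2 V → ℝ),
        T.IsTree → T ≤ Efull → (∃! b, T.Adj root b) →
        (∀ e ∈ T.edgeSet, rmin ≤ r e ∧ r e ≤ rmax) →
        (∀ e ∈ T.edgeSet, xmin ≤ x e ∧ x e ≤ xmax) →
      ∀ μ : Measure (Injection root), IsInjectionLaw μ →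
        (∀ a, varmin ≤ Var[fun s ↦ s.1 a; μ] + Var[fun s ↦ s.2 a; μ]) →
        (∀ a, Var[fun s ↦ s.1 a; μ] ≤ varmax ∧ Var[fun s ↦ s.2 a; μ] ≤ varmax) →
      ∀ (η : ℝ), 0 < η → η < 1 →
      ∀ n : ℕ, C * (treeDepth T root : ℝ) ^ 4 * (Fintype.card V : ℝ) ^ 2 *
          Real.log (Fintype.card V / η) < n →
      -- `n` independent samples of the injections and the resulting voltages
      ∀ (Ω : Type*) [MeasurableSpace Ω] (P : Measure Ω) [IsProbabilityMeasure P]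
        (s : Fin n → Ω → Injection root) (v θ : Fin n → Ω → V → ℝ),
        (∀ k, HasLaw (s k) μ P) → iIndepFun s P →
        (∀ k ω, IsLCPF T root r x (s k ω) (v k ω) (θ k ω)) →
        1 - η ≤ P.real {ω | mstOutputs Efull (fun k ↦ v k ω) = {T}} := by
  set m := min rmin xmin with hm_def
  have hm : 0 < m := lt_min hrmin hxmin
  set γ := m ^ 2 * varmin with hγ_def
  have hγ : 0 < γ := by positivity
  set K := 8 * |varmax| * (rmax ^ 2 + xmax ^ 2) + γ with hK_def
  have hK : 0 < K := by positivity
  refine ⟨96 * K ^ 2 / γ ^ 2, by positivity, ?_⟩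
  intro V _ root T G r x hT hTG hroot hr hx μ hμ hσ hM η hη hη1 n hn Ω _ P _ s v θ hs hind hv
  classical
  obtain ⟨b₀, hb₀, -⟩ := hroot
  have hr0 : ∀ e ∈ T.edgeSet, 0 < r e := fun e he ↦ hrmin.trans_le (hr e he).1
  have hx0 : ∀ e ∈ T.edgeSet, 0 < x e := fun e he ↦ hxmin.trans_le (hx e he).1
  have hM' : ∀ u, Var[fun s ↦ s.1 u; μ] ≤ |varmax| ∧ Var[fun s ↦ s.2 u; μ] ≤ |varmax| :=
    fun u ↦ ⟨(hM u).1.trans (le_abs_self _), (hM u).2.trans (le_abs_self _)⟩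
  have hN : (2 : ℝ) ≤ Fintype.card V := by
    exact_mod_cast Fintype.one_lt_card_iff.2 ⟨root, b₀, hb₀.ne⟩
  have hD : (1 : ℝ) ≤ treeDepth T root := by
    have h := Finset.le_sup (f := fun a ↦ T.dist root a) (Finset.mem_univ b₀)
    rw [dist_eq_one_iff_adj.2 hb₀] at h
    exact_mod_cast h
  set N : ℝ := (Fintype.card V : ℝ)
  set D : ℝ := (treeDepth T root : ℝ) with hD_def
  have hn0 : 0 < n := by
    have hlog : 0 < Real.log (N / η) := Real.log_pos ((one_lt_div hη).2 (by linarith))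
    have : (0 : ℝ) < n := lt_trans (by positivity) hn
    exact_mod_cast this
  choose p hp using fun a b ↦ (hT.connected.preconnected a b).exists_isPath
  let Vp : NonRoot root → ℝ := fun u ↦ Var[fun s ↦ s.1 u; μ]
  let Vq : NonRoot root → ℝ := fun u ↦ Var[fun s ↦ s.2 u; μ]
  let κ : NonRoot root → ℝ := fun u ↦ cov[fun s ↦ s.2 u, fun s ↦ s.1 u; μ]
  have hVp : ∀ u, 0 ≤ Vp u := fun u ↦ variance_nonneg _ _
  have hVq : ∀ u, 0 ≤ Vq u := fun u ↦ variance_nonneg _ _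
  let φ : V → V → ℝ := fun a b ↦ dropVar r x Vp Vq κ (p a b)
  have hgap : ∀ a b, a ≠ b → ¬ T.Adj a b → ∀ q : T.Walk a b, q.IsPath → ∀ e ∈ q.darts,
      φ e.fst e.snd + γ ≤ φ a b := by
    intro a b hab hadj q hq e he
    have h1 : p a b = q := (hT.existsUnique_path a b).unique (hp a b) hq
    have h2 : p e.fst e.snd = Walk.cons e.adj Walk.nil :=
      (hT.existsUnique_path _ _).unique (hp _ _) (by simp [e.adj.ne])
    simp only [φ, h1, h2]
    exact dropVar_cons_nil_add_le hT hm hvarmin.le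
      (fun e he ↦ (min_le_left _ _).trans (hr e he).1)
      (fun e he ↦ (min_le_right _ _).trans (hx e he).1) hVp hVq hμ.cov_qp_self hσ hq hab hadj he
  have hφB : ∀ a b, φ a b ≤ K * D ^ 2 * N := by
    intro a b
    have h := dropVar_le (fun e he ↦ ⟨hr0 e he, (hr e he).2⟩) (fun e he ↦ ⟨hx0 e he, (hx e he).2⟩)
      (abs_nonneg varmax) (fun u ↦ (hM' u).1) (fun u ↦ (hM' u).2) hμ.cov_qp_self
      (fun u ↦ hμ.covariance_le (hM' u).1 (hM' u).2) (p a b)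
    have hlen : ((p a b).length : ℝ) ≤ 2 * D := by
      rw [hD_def]
      exact_mod_cast (hp a b).length_le_two_mul_treeDepth hT root
    calc φ a b ≤ 2 * |varmax| * (rmax ^ 2 + xmax ^ 2) * ((p a b).length : ℝ) ^ 2 * N := h
      _ ≤ 2 * |varmax| * (rmax ^ 2 + xmax ^ 2) * (2 * D) ^ 2 * N := by gcongr
      _ = (K - γ) * D ^ 2 * N := by rw [hK_def]; ring
      _ ≤ K * D ^ 2 * N := by gcongr; linarith
  have hεB : γ / 2 ≤ K * D ^ 2 * N := by
    calc γ / 2 ≤ γ * 1 ^ 2 * 1 := by linarith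
      _ ≤ K * D ^ 2 * N := by
        gcongr
        · rw [hK_def]
          have : 0 ≤ 8 * |varmax| * (rmax ^ 2 + xmax ^ 2) := by positivity
          linarith
        · linarith
  -- The event that the estimate for the pair `ab` is off by at least half of the gap.
  let bad : V × V → Set Ω := fun ab ↦
    {ω | γ / 2 ≤ |(∑ k, (v k ω ab.1 - v k ω ab.2) ^ 2) / (n : ℝ) - φ ab.1 ab.2|}
  have hbad : ∀ ab, P.real (bad ab) ≤
      2 * Real.exp (-(n * (γ / 2) ^ 2 / (8 * (K * D ^ 2 * N) ^ 2))) := by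
    rintro ⟨a, b⟩
    let f : Injection root → ℝ := fun s ↦ ∑ u : NonRoot root,
      (dropCoeff root r (p a b) u * s.1 u + dropCoeff root x (p a b) u * s.2 u)
    have hf : Measurable f := by fun_prop
    have hvf : ∀ k ω, v k ω a - v k ω b = f (s k ω) := fun k ω ↦
      (hv k ω).sub_eq_sum_dropCoeff hT hr0 (p a b)
    have hφ : φ a b = Var[f; μ] := (hμ.variance_sum _ _).symm
    have hφ' : ((Var[f; μ]).toNNReal : ℝ) = φ a b := by
      rw [hφ, Real.coe_toNNReal _ (variance_nonneg _ _)]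
    have hlaw : ∀ k, HasLaw (fun ω ↦ f (s k ω)) (gaussianReal 0 (Var[f; μ]).toNNReal) P := by
      intro k
      have h : HasLaw f (gaussianReal 0 (Var[f; μ]).toNNReal) μ :=
        ⟨hf.aemeasurable, hμ.map_sum_eq_gaussianReal _ _⟩
      exact h.comp (hs k)
    have h := measureReal_abs_sum_sq_div_sub_ge_le hlaw (hind.comp (fun _ ↦ f) (fun _ ↦ hf)) hn0
      (by rw [hφ']; exact hφB a b) (half_pos hγ) hεB
    simpa only [bad, hvf, hφ'] using h
  have hsub : (Set.univ : Set Ω) ⊆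
      {ω | mstOutputs G (fun k ↦ v k ω) = {T}} ∪ ⋃ ab, bad ab := by
    intro ω _
    by_cases h : ω ∈ ⋃ ab, bad ab
    · exact Or.inr h
    · refine Or.inl (mstOutputs_eq_singleton hT hTG hgap fun a b ↦ ?_)
      exact not_le.1 fun hab ↦ h (Set.mem_iUnion.2 ⟨(a, b), hab⟩)
  have hunion : P.real (⋃ ab, bad ab) ≤ η := by
    calc P.real (⋃ ab, bad ab) ≤ ∑ ab, P.real (bad ab) := measureReal_iUnion_fintype_le _
      _ ≤ ∑ _ab : V × V, 2 * Real.exp (-(n * (γ / 2) ^ 2 / (8 * (K * D ^ 2 * N) ^ 2))) :=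
        Finset.sum_le_sum fun ab _ ↦ hbad ab
      _ = N * N * (2 * Real.exp (-(n * (γ / 2) ^ 2 / (8 * (K * D ^ 2 * N) ^ 2)))) := by
        simp [Fintype.card_prod, N]
      _ ≤ η := card_sq_mul_two_mul_exp_le hN hη hη1 hγ (by linarith) hK hn
  -- Subadditivity avoids any question about the measurability of the event of success.
  have htot : (1 : ℝ) ≤ P.real {ω | mstOutputs G (fun k ↦ v k ω) = {T}} +
      P.real (⋃ ab, bad ab) := by
    rw [← probReal_univ (μ := P)]
    exact (measureReal_mono hsub).trans (measureReal_union_le _ _)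
  linarith
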